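/- Let $n\in\mathbb N$, let $1\le p<\infty$ be real, and let $(\Omega,P)$ be a probability space. Let $\mathcal S$ be the set of random vectors $s=(s_1,\dots,s_n)$ on $\Omega$ with independent components such that every $s_i$ has a twice differentiable density $f_i$ with bounded support and $f_i''\in L^p(\mathbb R)$. Let $\mathcal H$ be the set of invertible real $n\times n$ matrices, $\mathcal X=\mathcal H\cdot\mathcal S=\{Hs: H\in\mathcal H,\ s\in\mathcal S\}$, and let $\mathcal T\subset\mathcal H$ be the set of trivial filters $T=\Pi\Lambda$, where $\Pi$ is a permutation matrix and $\Lambda$ is a diagonal matrix with non-zero diagonal entries. For a random vector $y$ let $z$ be its normalization, $z_i=(y_i-\mathbb E y_i)/\sigma_{y_i}$, let $p_z$ and $p_{z_i}$ be the joint and marginal densities of $z$ (taken continuous), and let $$A(z)=\nabla^2\Big(\prod_{i=1}^n p_{z_i}(z_i)\Big)-\nabla^2 p_z(z)$$ be the Hessian function difference (HFD). Put $$A_p(y)=\Big(\sum_{i,j=1}^n\int_{\mathbb R^n}|A_{ij}(z)|^p\,dz\Big)^{1/p},\qquad \Phi_p(H;x)=-A_p(Hx).$$ Then for every $y\in\mathcal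 X$ the normalized vector has twice differentiable joint and marginal densities with bounded support and $A_{ij}\in L^p(\mathbb R^n)$ for all $i,j$, so that $\Phi_p:\mathcal H\times\mathcal X\to\mathbb R$ is well defined; and $\Phi_p$ is a contrast for linear blind source separation, that is, $\Phi_p(H;x)$ depends on $x$ only through its law, and (a) (invariance) $\Phi_p(T;x)=\Phi_p(I;x)$ for all $x\in\mathcal X$, $T\in\mathcal T$; (b) (dominance) $\Phi_p(H;s)\le\Phi_p(I;s)$ for all $s\in\mathcal S$, $H\in\mathcal H$; (c) (discrimination) if $s\in\mathcal S$, $H\in\mathcal H$ and $\Phi_p(H;s)=\Phi_p(I;s)$, then $H\in\mathcal T$. Moreover, if $\mathcal S\neq\emptyset$, then $\mathcal T$ is exactly the set of all $T\in\mathcal H$ with $\Phi_p(T;x)=\Phi_p(I;x)$ for all $x\in\mathcal X$. -/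

import Mathlib

open MeasureTheory ProbabilityTheory
open scoped Matrix

noncomputable section

namespace HFDContrast

/-- `f` is a probability density function of the law `ν` (with respect to Lebesgue measure). -/
def IsPDF {E : Type*} [MeasureSpace E] (ν : Measure E) (f : E → ℝ) : Prop :=
  Measurable f ∧ (∀ x, 0 ≤ f x) ∧ ν = volume.withDensity (fun x => ENNReal.ofReal (f x))

/-- `f` is twice differentiable at every point. -/
def TwiceDifferentiable {E : Type*} [NormedAddCommGroup E] [NormedSpace ℝ E] (f : E → ℝ) : Prop :=
  Differentiable ℝ f ∧ Differentiable ℝ (fderiv ℝ f)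

open Classical in
/-- The density of the law `ν`: its continuous density (unique, hence independent of the choice)
when there is one, otherwise the Radon-Nikodym derivative. -/
def pdfOf {E : Type*} [TopologicalSpace E] [MeasureSpace E] (ν : Measure E) : E → ℝ :=
  if h : ∃ f : E → ℝ, Continuous f ∧ IsPDF ν f then h.choose
  else fun x => (ν.rnDeriv volume x).toReal

/-- `ν` has a twice differentiable density that vanishes outside a bounded set. -/
def HasRegularPDF {E : Type*} [NormedAddCommGroup E] [NormedSpace ℝ E] [MeasureSpace E]
    (ν : Measure E) : Prop :=
  ∃ f : E → ℝ, IsPDF ν f ∧ TwiceDifferentiable f ∧ Bornology.IsBounded (Function.support f)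

variable {n : ℕ}

/-- The `i`-th partial derivative. -/
def partialDeriv (i : Fin n) (f : (Fin n → ℝ) → ℝ) (x : Fin n → ℝ) : ℝ :=
  fderiv ℝ f x (Pi.single i 1)

/-- The Hessian matrix of `f` at `x`. -/
def hessian (f : (Fin n → ℝ) → ℝ) (x : Fin n → ℝ) : Matrix (Fin n) (Fin n) ℝ :=
  Matrix.of fun i j => partialDeriv i (partialDeriv j f) x

/-- The product of the marginal densities of `ν`. -/
def prodMarginalPDF (ν : Measure (Fin n → ℝ)) (x : Fin n → ℝ) : ℝ :=
  ∏ i, pdfOf (ν.map (fun y : Fin n → ℝ => y i)) (x i)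

/-- The Hessian function difference: Hessian of the product of the marginal densities minus
Hessian of the joint density. -/
def HFD (ν : Measure (Fin n → ℝ)) (x : Fin n → ℝ) : Matrix (Fin n) (Fin n) ℝ :=
  hessian (prodMarginalPDF ν) x - hessian (pdfOf ν) x

/-- The entrywise `L^p` norm of the Hessian function difference. -/
def hfdNorm (p : ℝ) (ν : Measure (Fin n → ℝ)) : ℝ :=
  (∑ i, ∑ j, ∫ x, |HFD ν x i j| ^ p) ^ (1 / p)

variable {Ω : Type*} [MeasurableSpace Ω]

/-- The normalized random vector: every component is shifted and scaled to mean zero and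
variance one. -/
def normalize (P : Measure Ω) (y : Ω → Fin n → ℝ) : Ω → Fin n → ℝ := fun ω i =>
  (y ω i - ∫ ω', y ω' i ∂P) / Real.sqrt (variance (fun ω' => y ω' i) P)

/-- The independence measure `A_p(y)`: the `L^p` norm of the Hessian function difference of the
normalized random vector. -/
def hfdMeasure (P : Measure Ω) (p : ℝ) (y : Ω → Fin n → ℝ) : ℝ :=
  hfdNorm p (P.map (normalize P y))

/-- A linear filter acting on a random vector. -/
def act (H : Matrix (Fin n) (Fin n) ℝ) (x : Ω → Fin n → ℝ) : Ω → Fin n → ℝ :=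
  fun ω => H *ᵥ x ω

/-- The criterion `Φ(H; x) = - A_p(H x)`. -/
def hfdCriterion (P : Measure Ω) (p : ℝ) (H : Matrix (Fin n) (Fin n) ℝ)
    (x : Ω → Fin n → ℝ) : ℝ :=
  -hfdMeasure P p (act H x)

/-- The set `𝓗 · 𝓢` of mixtures. -/
def mixtures (𝓗 : Set (Matrix (Fin n) (Fin n) ℝ)) (𝓢 : Set (Ω → Fin n → ℝ)) :
    Set (Ω → Fin n → ℝ) :=
  {x | ∃ H ∈ 𝓗, ∃ s ∈ 𝓢, x = act H s}

/-- `Φ` is a contrast for the filters `𝓗`, the trivial filters `𝓣` and the sources `𝓢`. -/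
structure IsContrast (P : Measure Ω) (𝓗 𝓣 : Set (Matrix (Fin n) (Fin n) ℝ))
    (𝓢 : Set (Ω → Fin n → ℝ))
    (Φ : Matrix (Fin n) (Fin n) ℝ → (Ω → Fin n → ℝ) → ℝ) : Prop where
  one_mem : 1 ∈ 𝓗
  trivial_subset : 𝓣 ⊆ 𝓗
  depends_on_law : ∀ H ∈ 𝓗, ∀ x ∈ mixtures 𝓗 𝓢, ∀ x' ∈ mixtures 𝓗 𝓢,
    P.map x = P.map x' → Φ H x = Φ H x'
  invariance : ∀ x ∈ mixtures 𝓗 𝓢, ∀ T ∈ 𝓣, Φ T x = Φ 1 x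
  dominance : ∀ s ∈ 𝓢, ∀ H ∈ 𝓗, Φ H s ≤ Φ 1 s
  discrimination : ∀ s ∈ 𝓢, ∀ H ∈ 𝓗, Φ H s = Φ 1 s → H ∈ 𝓣

/-- The filters of linear blind source separation: the invertible matrices. -/
def linearFilters (n : ℕ) : Set (Matrix (Fin n) (Fin n) ℝ) := {H | IsUnit H.det}

/-- The trivial filters: a permutation matrix times an invertible diagonal matrix. -/
def trivialFilters (n : ℕ) : Set (Matrix (Fin n) (Fin n) ℝ) :=
  {T | ∃ (σ : Equiv.Perm (Fin n)) (d : Fin n → ℝ), (∀ i, d i ≠ 0) ∧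
    T = σ.permMatrix ℝ * Matrix.diagonal d}

/-- The sources: random vectors with independent components, each of which has a twice
differentiable density with bounded support and `L^p` second derivative. -/
def sources (P : Measure Ω) (n : ℕ) (p : ℝ) : Set (Ω → Fin n → ℝ) :=
  {s | Measurable s ∧ iIndepFun (fun i ω => s ω i) P ∧
    ∀ i, ∃ f : ℝ → ℝ, IsPDF (P.map fun ω => s ω i) f ∧ TwiceDifferentiable f ∧
      Bornology.IsBounded (Function.support f) ∧
      MemLp (deriv (deriv f)) (ENNReal.ofReal p) volume}

end HFDContrast

end

/-! Normalizing `H s` composes `s` with an invertible affine map, so its joint density is an affine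
image of the product of the source densities, and its marginals come from convolutions of rescaled
source densities. Both operations preserve regularity (`IsRegular`), which makes the criterion well
defined; `exists_isMixtureLaw` collects these facts.

For a source vector the product of the marginal densities is itself a continuous joint density, so
the HFD vanishes and dominance is just nonnegativity of the norm. A trivial filter becomes a signed
permutation after normalization, and the entrywise norm does not see it (`hfdNorm_map_signedPerm`).

Discrimination uses the bounded supports. If the HFD vanishes almost everywhere, the difference of
the two densities has zero second derivative along almost every line in a coordinate direction;
since it vanishes far out, it is zero (`eq_zero_of_ae_fderiv_fderiv_eq_zero`). Comparing supports,
the affine map `x ↦ M x + b` carries one product of bounded open sets onto another. Its side lengths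
`α`, `γ` satisfy `|M| α ≤ γ` and `|M⁻¹| γ ≤ α`, so `|M⁻¹| |M| α ≤ α`. As the diagonal of `|M⁻¹| |M|`
is at least 1, no positive off-diagonal entry is possible, which leaves a single nonzero entry in
each row (`eq_of_ne_zero_of_map_box`). -/

namespace HFDContrast

open Set Function

/-! ### Continuous densities and affine changes of variables -/

section Density

variable {E : Type*} [NormedAddCommGroup E] [NormedSpace ℝ E] [FiniteDimensional ℝ E]
  [MeasureSpace E] [(volume : Measure E).IsAddHaarMeasure]

/-- A continuous density is unique. -/
theorem IsPDF.eq_of_continuous {ν : Measure E} {f g : E → ℝ} (hf : IsPDF ν f) (hg : IsPDF ν g)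
    (hfc : Continuous f) (hgc : Continuous g) : f = g := by
  have h := hf.2.2.symm.trans hg.2.2
  rw [withDensity_eq_iff_of_sigmaFinite (by have := hf.1; fun_prop)
    (by have := hg.1; fun_prop)] at h
  refine Continuous.ae_eq_iff_eq volume hfc hgc |>.1 ?_
  filter_upwards [h] with x hx
  exact (ENNReal.ofReal_eq_ofReal_iff (hf.2.1 x) (hg.2.1 x)).1 hx

theorem pdfOf_eq {ν : Measure E} {f : E → ℝ} (hf : IsPDF ν f) (hfc : Continuous f) :
    pdfOf ν = f := by
  have h : ∃ f : E → ℝ, Continuous f ∧ IsPDF ν f := ⟨f, hfc, hf⟩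
  rw [pdfOf, dif_pos h]
  exact h.choose_spec.2.eq_of_continuous hf h.choose_spec.1 hfc

variable [BorelSpace E]

theorem map_volume_affine (L : E ≃L[ℝ] E) (b : E) :
    (volume : Measure E).map (fun x => L x + b)
      = ENNReal.ofReal |(LinearMap.det (L : E →ₗ[ℝ] E))⁻¹| • volume := by
  have h1 := Measure.map_linearMap_addHaar_eq_smul_addHaar (volume : Measure E)
    (LinearEquiv.isUnit_det' L.toLinearEquiv).ne_zero
  have h2 : (fun x => L x + b) = (fun x => x + b) ∘ (L : E →ₗ[ℝ] E) := rfl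
  rw [h2, ← Measure.map_map (by fun_prop) (by exact L.continuous.measurable)]
  erw [h1]
  rw [Measure.map_smul, map_add_right_eq_self]

/-- The density of an invertible affine image. -/
theorem IsPDF.map_affine {ν : Measure E} {f : E → ℝ} (hf : IsPDF ν f) (L : E ≃L[ℝ] E) (b : E) :
    IsPDF (ν.map fun x => L x + b)
      (fun y => |(LinearMap.det (L : E →ₗ[ℝ] E))⁻¹| * f (L.symm (y - b))) := by
  obtain ⟨hm, h0, rfl⟩ := hf
  have hm' : Measurable fun y => f (L.symm (y - b)) := by fun_prop
  refine ⟨by fun_prop, fun y => mul_nonneg (abs_nonneg _) (h0 _), ?_⟩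
  have hmL : Measurable fun x => L x + b := by fun_prop
  ext s hs
  rw [Measure.map_apply hmL hs, withDensity_apply _ (hmL hs), withDensity_apply _ hs]
  -- Writing the integrand as a function of `L x + b` turns the integral into one against the image
  -- of Lebesgue measure.
  have h3 : ∀ x, ENNReal.ofReal (f x) = ENNReal.ofReal (f (L.symm ((L x + b) - b))) := by simp
  simp_rw [ENNReal.ofReal_mul (abs_nonneg _)]
  rw [lintegral_const_mul _ (by fun_prop), setLIntegral_congr_fun (hmL hs) fun x _ => h3 x,
    ← setLIntegral_map (f := fun y => ENNReal.ofReal (f (L.symm (y - b)))) hs (by fun_prop) hmL,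
    map_volume_affine, Measure.restrict_smul, lintegral_smul_measure, smul_eq_mul]

end Density

/-! ### Second derivatives, and vanishing from a null second derivative -/

section TwiceDifferentiable

variable {E : Type*} [NormedAddCommGroup E] [NormedSpace ℝ E]

theorem twiceDifferentiable_iff_deriv {f : ℝ → ℝ} :
    TwiceDifferentiable f ↔ Differentiable ℝ f ∧ Differentiable ℝ (deriv f) := by
  refine and_congr_right fun _ => ⟨fun h => ?_, fun h => ?_⟩
  · have : deriv f = fun x => fderiv ℝ f x 1 := by ext; simp
    rw [this]; fun_prop
  · have : fderiv ℝ f = fun x => deriv f x • (1 : ℝ →L[ℝ] ℝ) := by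
      ext x; simp
    rw [this]; fun_prop

theorem TwiceDifferentiable.continuous {f : E → ℝ} (hf : TwiceDifferentiable f) :
    Continuous f := hf.1.continuous

/-- Links the iterated partial derivatives in `hessian` to the bilinear second derivative, which
transforms simply under linear maps. -/
theorem fderiv_fderiv_apply {f : E → ℝ} (hf : TwiceDifferentiable f) (v w x : E) :
    fderiv ℝ (fun y => fderiv ℝ f y w) x v = fderiv ℝ (fderiv ℝ f) x v w := by
  rw [fderiv_clm_apply (hf.2 x) (by fun_prop)]
  simp

theorem TwiceDifferentiable.sub {f g : E → ℝ} (hf : TwiceDifferentiable f)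
    (hg : TwiceDifferentiable g) : TwiceDifferentiable (fun x => f x - g x) := by
  refine ⟨hf.1.sub hg.1, ?_⟩
  have : fderiv ℝ (fun x => f x - g x) = fun x => fderiv ℝ f x - fderiv ℝ g x := by
    ext1 x; exact fderiv_fun_sub (hf.1 x) (hg.1 x)
  rw [this]
  exact hf.2.sub hg.2

theorem fderiv_fderiv_sub {f g : E → ℝ} (hf : TwiceDifferentiable f)
    (hg : TwiceDifferentiable g) (x : E) :
    fderiv ℝ (fderiv ℝ fun x => f x - g x) x
      = fderiv ℝ (fderiv ℝ f) x - fderiv ℝ (fderiv ℝ g) x := by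
  have : fderiv ℝ (fun x => f x - g x) = fun x => fderiv ℝ f x - fderiv ℝ g x := by
    ext1 x; exact fderiv_fun_sub (hf.1 x) (hg.1 x)
  rw [this, fderiv_fun_sub (hf.2 x) (hg.2 x)]

theorem fderiv_comp_affine {f : E → ℝ} (hf : TwiceDifferentiable f) (L : E →L[ℝ] E) (b : E)
    (c : ℝ) (x v : E) :
    fderiv ℝ (fun x => c * f (L (x - b))) x v = c * fderiv ℝ f (L (x - b)) (L v) := by
  have h : HasFDerivAt (fun x => L (x - b)) L x :=
    L.hasFDerivAt.comp x ((hasFDerivAt_id x).sub_const b)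
  have h2 : HasFDerivAt (fun x => c * f (L (x - b))) (c • (fderiv ℝ f (L (x - b))).comp L) x :=
    ((hf.1 (L (x - b))).hasFDerivAt.comp x h).const_mul c
  rw [h2.fderiv]; simp

theorem fderiv_fderiv_comp_affine {f : E → ℝ} (hf : TwiceDifferentiable f) (L : E →L[ℝ] E)
    (b : E) (c : ℝ) :
    TwiceDifferentiable (fun x => c * f (L (x - b))) ∧ ∀ x v w,
      fderiv ℝ (fderiv ℝ fun x => c * f (L (x - b))) x v w
        = c * fderiv ℝ (fderiv ℝ f) (L (x - b)) (L v) (L w) := by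
  have hd : Differentiable ℝ (fun x => L (x - b)) := by fun_prop
  have h1 : Differentiable ℝ (fun x => c * f (L (x - b))) := (hf.1.comp hd).const_mul c
  have h2 : fderiv ℝ (fun x => c * f (L (x - b)))
      = fun x => c • (fderiv ℝ f (L (x - b))).comp L := by
    ext x v; rw [fderiv_comp_affine hf]; simp
  have hd2 : Differentiable ℝ (fun x => fderiv ℝ f (L (x - b))) := hf.2.comp hd
  have h3 : TwiceDifferentiable (fun x => c * f (L (x - b))) := by
    refine ⟨h1, ?_⟩
    rw [h2]
    exact (hd2.clm_comp (differentiable_const L)).const_smul c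
  refine ⟨h3, fun x v w => ?_⟩
  rw [← fderiv_fderiv_apply h3]
  simp_rw [fderiv_comp_affine hf]
  have h : HasFDerivAt (fun x => L (x - b)) L x :=
    L.hasFDerivAt.comp x ((hasFDerivAt_id x).sub_const b)
  have h4 := (((hf.2 (L (x - b))).hasFDerivAt.comp x h).clm_apply
    (hasFDerivAt_const (L w) x)).const_mul c
  simp only [Function.comp_def] at h4
  rw [h4.fderiv]
  simp

/-- An everywhere differentiable function on the line with a zero vanishes if its derivative
vanishes almost everywhere. -/
theorem eq_zero_of_ae_deriv_eq_zero {φ φ' : ℝ → ℝ} (h : ∀ t, HasDerivAt φ (φ' t) t)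
    (h0 : ∀ᵐ t, φ' t = 0) {R : ℝ} (hR : φ R = 0) (x : ℝ) : φ x = 0 := by
  have hz : φ' =ᵐ[volume] fun _ => (0 : ℝ) := h0
  -- Integrability, needed for the fundamental theorem of calculus, is free as `φ'` is a.e. zero.
  -- Differentiability at every point is essential: the Cantor function is a counterexample
  -- otherwise.
  have hint : IntervalIntegrable φ' volume R x :=
    (intervalIntegrable_const (c := (0 : ℝ))).congr_ae (ae_restrict_of_ae hz.symm)
  have h2 := intervalIntegral.integral_eq_sub_of_hasDerivAt (fun t _ => h t) hint
  rw [intervalIntegral.integral_congr_ae (g := fun _ => (0 : ℝ))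
    (h0.mono fun t ht _ => ht)] at h2
  simp [hR] at h2
  linarith

theorem support_fderiv_subset_of_isClosed {f : E → ℝ} {K : Set E} (hK : IsClosed K)
    (h : support f ⊆ K) : support (fderiv ℝ f) ⊆ K :=
  (support_fderiv_subset ℝ).trans (hK.closure_subset_iff.2 h)

/-- A twice differentiable function with bounded support vanishes if its second derivative in some
nonzero direction vanishes almost everywhere. -/
theorem eq_zero_of_ae_fderiv_fderiv_eq_zero [FiniteDimensional ℝ E] [MeasureSpace E]
    [BorelSpace E] [(volume : Measure E).IsAddHaarMeasure] {D : E → ℝ}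
    (hD : TwiceDifferentiable D) (hb : Bornology.IsBounded (support D)) {v : E} (hv : v ≠ 0)
    (h : ∀ᵐ x, fderiv ℝ (fderiv ℝ D) x v v = 0) (x : E) : D x = 0 := by
  suffices hae : D =ᵐ[volume] fun _ => (0 : ℝ) from
    congrFun ((Continuous.ae_eq_iff_eq volume hD.continuous continuous_const).1 hae) x
  have hms : MeasurableSet {x : E | fderiv ℝ (fderiv ℝ D) x v v = 0} := by
    have h1 : Measurable fun x => fderiv ℝ (fderiv ℝ D) x v v := by
      simp_rw [← fderiv_fderiv_apply hD]
      exact measurable_fderiv_apply_const ℝ _ v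
    exact h1 (measurableSet_singleton 0)
  -- Fubini along the direction `v`: for almost every `y` the condition holds at almost every point
  -- of the line `y + t v`.
  have h2 := (ae_ae_add_linearMap_mem_iff (LinearMap.toSpanSingleton ℝ E v)
    (volume : Measure ℝ) (volume : Measure E) hms).2 h
  obtain ⟨r, hr⟩ := hb.subset_closedBall 0
  filter_upwards [h2] with y hy
  simp only [LinearMap.toSpanSingleton_apply] at hy
  have hvn : 0 < ‖v‖ := norm_pos_iff.2 hv
  have hfar : ∃ R : ℝ, y + R • v ∉ Metric.closedBall (0 : E) r := by
    -- The displacement has length `|r| + ‖y‖ + 1`, enough to leave the ball from any starting point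
    -- `y`.
    refine ⟨(|r| + ‖y‖ + 1) / ‖v‖, fun hmem => ?_⟩
    rw [mem_closedBall_zero_iff] at hmem
    have h3 : ‖((|r| + ‖y‖ + 1) / ‖v‖) • v‖ = |r| + ‖y‖ + 1 := by
      rw [norm_smul, Real.norm_of_nonneg (by positivity)]; field_simp
    have h4 := norm_sub_le (y + ((|r| + ‖y‖ + 1) / ‖v‖) • v) y
    rw [add_sub_cancel_left, h3] at h4
    linarith [le_abs_self r]
  obtain ⟨R, hR⟩ := hfar
  have hline : ∀ t : ℝ, HasDerivAt (fun t : ℝ => y + t • v) v t := fun t => by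
    simpa using ((hasDerivAt_id t).smul_const v).const_add y
  have hφ : ∀ t : ℝ, HasDerivAt (fun t : ℝ => D (y + t • v)) (fderiv ℝ D (y + t • v) v) t :=
    fun t => (hD.1 _).hasFDerivAt.comp_hasDerivAt t (hline t)
  have hφ' : ∀ t : ℝ, HasDerivAt (fun t : ℝ => fderiv ℝ D (y + t • v) v)
      (fderiv ℝ (fderiv ℝ D) (y + t • v) v v) t := fun t => by
    rw [← fderiv_fderiv_apply hD]
    exact HasFDerivAt.comp_hasDerivAt t
      (f := fun t : ℝ => y + t • v) (l := fun z => fderiv ℝ D z v)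
      (((hD.2 _).clm_apply (differentiableAt_const v)).hasFDerivAt) (hline t)
  have hD0 : D (y + R • v) = 0 := notMem_support.1 fun hh => hR (hr hh)
  have hD1 : fderiv ℝ D (y + R • v) = 0 := notMem_support.1 fun hh =>
    hR (support_fderiv_subset_of_isClosed Metric.isClosed_closedBall hr hh)
  have h5 := eq_zero_of_ae_deriv_eq_zero hφ' hy (R := R) (by rw [hD1]; rfl)
  have h6 := eq_zero_of_ae_deriv_eq_zero hφ (Filter.Eventually.of_forall h5) hD0 0
  simpa using h6

end TwiceDifferentiable

/-! ### The class of regular functions and its affine invariance -/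

section Regular

/-- Twice differentiable functions with bounded support and `L^p` second derivative. -/
def IsRegular {E : Type*} [NormedAddCommGroup E] [NormedSpace ℝ E] [MeasureSpace E]
    (p : ℝ) (f : E → ℝ) : Prop :=
  TwiceDifferentiable f ∧ Bornology.IsBounded (support f) ∧
    ∀ v w, MemLp (fun x => fderiv ℝ (fderiv ℝ f) x v w) (ENNReal.ofReal p) volume

theorem isRegular_iff_deriv {p : ℝ} {f : ℝ → ℝ} :
    IsRegular p f ↔ TwiceDifferentiable f ∧ Bornology.IsBounded (support f) ∧
      MemLp (deriv (deriv f)) (ENNReal.ofReal p) volume := by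
  refine and_congr_right fun hf => and_congr_right fun _ => ?_
  have key : ∀ v w x, fderiv ℝ (fderiv ℝ f) x v w = (v * w) * deriv (deriv f) x := by
    intro v w x
    rw [← fderiv_fderiv_apply hf]
    have : (fun y => fderiv ℝ f y w) = fun y => w * deriv f y := by
      ext y; simp [fderiv_eq_smul_deriv]
    rw [this, fderiv_eq_smul_deriv, deriv_const_mul _ ((twiceDifferentiable_iff_deriv.1 hf).2 x)]
    simp; ring
  simp_rw [key]
  refine ⟨fun h => by simpa using h 1 1, fun h v w => h.const_mul _⟩

variable {E : Type*} [NormedAddCommGroup E] [NormedSpace ℝ E] [FiniteDimensional ℝ E]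
  [MeasureSpace E]

theorem IsRegular.hasCompactSupport {p : ℝ} {f : E → ℝ} (hf : IsRegular p f) :
    HasCompactSupport f := hf.2.1.isCompact_closure

variable [BorelSpace E] [(volume : Measure E).IsAddHaarMeasure]

theorem _root_.MeasureTheory.MemLp.comp_affine {f : E → ℝ} {p : ENNReal}
    (hf : MemLp f p volume) (L : E ≃L[ℝ] E) (b : E) :
    MemLp (fun x => f (L x + b)) p volume := by
  have h : MemLp f p ((volume : Measure E).map fun x => L x + b) := by
    rw [map_volume_affine]
    exact hf.smul_measure ENNReal.ofReal_ne_top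
  exact h.comp_of_map (f := fun x => L x + b) (by fun_prop)

theorem IsRegular.comp_affine {p : ℝ} {f : E → ℝ} (hf : IsRegular p f) (L : E ≃L[ℝ] E) (b : E)
    (c : ℝ) : IsRegular p (fun x => c * f (L (x - b))) := by
  obtain ⟨h1, h2⟩ := fderiv_fderiv_comp_affine hf.1 (L : E →L[ℝ] E) b c
  refine ⟨h1, ?_, fun v w => ?_⟩
  · have hsub : support (fun x => c * f (L (x - b))) ⊆ (fun y => L.symm y + b) '' support f := by
      intro x hx
      refine ⟨L (x - b), ?_, by simp⟩
      exact right_ne_zero_of_mul hx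
    refine Bornology.IsBounded.subset ?_ hsub
    have hK := hf.2.1.isCompact_closure
    refine (hK.image (f := fun y => L.symm y + b) (by fun_prop)).isBounded.subset ?_
    exact image_mono subset_closure
  · have h3 := ((hf.2.2 (L v) (L w)).comp_affine L (-(L b))).const_mul c
    refine (memLp_congr_ae (Filter.Eventually.of_forall fun x => ?_)).1 h3
    have := h2 x v w
    simp only [ContinuousLinearEquiv.coe_coe] at this
    rw [this, map_sub, sub_eq_add_neg]

end Regular

/-! ### Convolution of regular densities -/

section Convolution

open scoped Convolution

theorem IsRegular.contDiff_one {p : ℝ} {f : ℝ → ℝ} (hf : IsRegular p f) : ContDiff ℝ 1 f :=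
  contDiff_one_iff_deriv.2 ⟨hf.1.1, (twiceDifferentiable_iff_deriv.1 hf.1).2.continuous⟩

/-- One derivative falls on each factor, so the second derivative is `f' ⋆ g'`, continuous with
compact support. It lies in every `L^r`, whence the free exponent. -/
theorem IsRegular.convolution {p q : ℝ} {f g : ℝ → ℝ} (hf : IsRegular p f) (hg : IsRegular q g)
    (r : ℝ) : IsRegular r (f ⋆[ContinuousLinearMap.mul ℝ ℝ, volume] g) := by
  have hf1 := hf.contDiff_one
  have hg1 := hg.contDiff_one
  have hfc := hf.hasCompactSupport
  have hgc := hg.hasCompactSupport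
  have hf'c : Continuous (deriv f) := hf1.continuous_deriv le_rfl
  have hg'c : Continuous (deriv g) := hg1.continuous_deriv le_rfl
  have h1 : ∀ x, HasDerivAt (f ⋆[ContinuousLinearMap.mul ℝ ℝ, volume] g)
      ((deriv f ⋆[ContinuousLinearMap.mul ℝ ℝ, volume] g) x) x := fun x =>
    hfc.hasDerivAt_convolution_left _ hf1 hg.1.continuous.locallyIntegrable x
  have h2 : ∀ x, HasDerivAt (deriv f ⋆[ContinuousLinearMap.mul ℝ ℝ, volume] g)
      ((deriv f ⋆[ContinuousLinearMap.mul ℝ ℝ, volume] deriv g) x) x := fun x =>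
    hgc.hasDerivAt_convolution_right _ hf'c.locallyIntegrable hg1 x
  have h3 : deriv (f ⋆[ContinuousLinearMap.mul ℝ ℝ, volume] g)
      = (deriv f ⋆[ContinuousLinearMap.mul ℝ ℝ, volume] g) := funext fun x => (h1 x).deriv
  refine isRegular_iff_deriv.2 ⟨twiceDifferentiable_iff_deriv.2
    ⟨fun x => (h1 x).differentiableAt, ?_⟩, ?_, ?_⟩
  · rw [h3]; exact fun x => (h2 x).differentiableAt
  · exact (hfc.convolution _ hgc).isCompact.isBounded.subset subset_closure
  · have h4 : deriv (deriv (f ⋆[ContinuousLinearMap.mul ℝ ℝ, volume] g))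
        = (deriv f ⋆[ContinuousLinearMap.mul ℝ ℝ, volume] deriv g) := by
      rw [h3]; exact funext fun x => (h2 x).deriv
    rw [h4]
    exact (hgc.deriv.continuous_convolution_right _ hf'c.locallyIntegrable
      hg'c).memLp_of_hasCompactSupport (hfc.deriv.convolution _ hgc.deriv)

theorem IsPDF.conv {ν μ : Measure ℝ} {f g : ℝ → ℝ} (hf : IsPDF ν f) (hg : IsPDF μ g)
    (hfc : Continuous f) (hgc : Continuous g) (hfs : HasCompactSupport f) :
    IsPDF (ν ∗ μ) (f ⋆[ContinuousLinearMap.mul ℝ ℝ, volume] g) := by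
  refine ⟨(hfs.continuous_convolution_left _ hfc hgc.locallyIntegrable).measurable,
    fun x => integral_nonneg fun t => mul_nonneg (hf.2.1 _) (hg.2.1 _), ?_⟩
  have hfm := hf.1
  have hgm := hg.1
  rw [hf.2.2, hg.2.2, conv_withDensity_eq_lconvolution (by fun_prop) (by fun_prop)]
  congr 1
  ext x
  rw [lconvolution_def, convolution_def, ofReal_integral_eq_lintegral_ofReal]
  · refine lintegral_congr fun t => ?_
    rw [← ENNReal.ofReal_mul (hf.2.1 _)]
    congr 2
    rw [neg_add_eq_sub]
  · exact (hfs.convolutionExists_left _ hfc hgc.locallyIntegrable x).integrable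
  · exact Filter.Eventually.of_forall fun t => mul_nonneg (hf.2.1 _) (hg.2.1 _)

end Convolution

/-! ### Products of one-dimensional densities -/

section Product

variable {n : ℕ}

/-- The product of functions of the single coordinates. -/
def prodFun (h : Fin n → ℝ → ℝ) (x : Fin n → ℝ) : ℝ := ∏ i, h i (x i)

/-- It suffices to compare on boxes, where the integral factors; integrability of each factor comes
from total mass one. -/
theorem isPDF_prodFun {μ : Fin n → Measure ℝ} [∀ i, IsProbabilityMeasure (μ i)]
    {f : Fin n → ℝ → ℝ} (hf : ∀ i, IsPDF (μ i) (f i)) : IsPDF (Measure.pi μ) (prodFun f) := by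
  have hm : Measurable (prodFun f) := by
    have := fun i => (hf i).1
    unfold prodFun; fun_prop
  have hint : ∀ i, Integrable (f i) := fun i => by
    refine ⟨(hf i).1.aestronglyMeasurable, ?_⟩
    rw [hasFiniteIntegral_iff_ofReal (Filter.Eventually.of_forall (hf i).2.1),
      ← setLIntegral_univ, ← withDensity_apply _ MeasurableSet.univ, ← (hf i).2.2]
    exact measure_lt_top _ _
  refine ⟨hm, fun x => Finset.prod_nonneg fun i _ => (hf i).2.1 _, Measure.pi_eq fun s hs => ?_⟩
  rw [withDensity_apply _ (MeasurableSet.univ_pi hs), volume_pi, Measure.restrict_pi_pi,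
    ← ofReal_integral_eq_lintegral_ofReal]
  · unfold prodFun
    rw [integral_fintype_prod_eq_prod (fun i t => f i t), ENNReal.ofReal_prod_of_nonneg
      fun i _ => integral_nonneg (hf i).2.1]
    refine Finset.prod_congr rfl fun i _ => ?_
    rw [ofReal_integral_eq_lintegral_ofReal (hint i).integrableOn
      (Filter.Eventually.of_forall (hf i).2.1), (hf i).2.2, withDensity_apply _ (hs i)]
  · exact Integrable.fintype_prod_dep fun i => (hint i).integrableOn
  · exact Filter.Eventually.of_forall fun x => Finset.prod_nonneg fun i _ => (hf i).2.1 _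

/-- With `update`, each partial derivative is again a `prodFun`, so the formula can be applied a
second time. -/
theorem hasFDerivAt_prodFun {h : Fin n → ℝ → ℝ} (hd : ∀ i, Differentiable ℝ (h i))
    (x : Fin n → ℝ) :
    HasFDerivAt (prodFun h) (∑ i, prodFun (update h i (deriv (h i))) x •
      ContinuousLinearMap.proj (R := ℝ) (φ := fun _ : Fin n => ℝ) i) x := by
  have h1 := HasFDerivAt.finsetProd (u := Finset.univ) (x := x)
    (g := fun i (x : Fin n → ℝ) => h i (x i))
    (g' := fun i => deriv (h i) (x i) • ContinuousLinearMap.proj (R := ℝ)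
      (φ := fun _ : Fin n => ℝ) i) fun i _ =>
    ((hd i) (x i)).hasDerivAt.comp_hasFDerivAt x
      (ContinuousLinearMap.proj (R := ℝ) (φ := fun _ : Fin n => ℝ) i).hasFDerivAt
  change HasFDerivAt (fun x : Fin n → ℝ => ∏ i, h i (x i)) _ x
  refine h1.congr_fderiv (Finset.sum_congr rfl fun i _ => ?_)
  rw [smul_smul, prodFun, ← Finset.prod_erase_mul _ _ (Finset.mem_univ i)]
  congr 2
  · exact Finset.prod_congr rfl fun j hj => by rw [update_of_ne (Finset.ne_of_mem_erase hj)]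
  · simp

theorem fderiv_prodFun_apply {h : Fin n → ℝ → ℝ} (hd : ∀ i, Differentiable ℝ (h i))
    (x w : Fin n → ℝ) :
    fderiv ℝ (prodFun h) x w = ∑ i, w i * prodFun (update h i (deriv (h i))) x := by
  rw [(hasFDerivAt_prodFun hd x).fderiv]
  simp [mul_comm]

theorem memLp_prodFun {p : ℝ} (hp : 1 ≤ p) {h : Fin n → ℝ → ℝ}
    (hm : ∀ i, MemLp (h i) (ENNReal.ofReal p) volume) :
    MemLp (prodFun h) (ENNReal.ofReal p) volume := by
  have hp0 : ENNReal.ofReal p ≠ 0 := by simp; linarith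
  have hI : ∀ i, Integrable (fun t => ‖h i t‖ ^ p) := fun i => by
    have := (hm i).integrable_norm_rpow hp0 ENNReal.ofReal_ne_top
    rwa [ENNReal.toReal_ofReal (by linarith)] at this
  have hmeas : AEStronglyMeasurable (prodFun h) volume := by
    unfold prodFun
    refine Finset.aestronglyMeasurable_fun_prod _ fun i _ => ?_
    exact (hm i).1.comp_quasiMeasurePreserving (Measure.quasiMeasurePreserving_eval (fun _ => volume) i)
  rw [← integrable_norm_rpow_iff hmeas hp0 ENNReal.ofReal_ne_top,
    ENNReal.toReal_ofReal (by linarith)]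
  have := Integrable.fintype_prod (μ := fun _ : Fin n => (volume : Measure ℝ)) hI
  refine this.congr (Filter.Eventually.of_forall fun x => ?_)
  simp only [prodFun, norm_prod]
  exact (Real.finsetProd_rpow _ _ (fun i _ => norm_nonneg _) p)

theorem isRegular_prodFun {p : ℝ} (hp : 1 ≤ p) {f : Fin n → ℝ → ℝ}
    (hf : ∀ i, IsRegular p (f i)) : IsRegular p (prodFun f) := by
  have hd : ∀ i, Differentiable ℝ (f i) := fun i => (hf i).1.1
  have hd2 : ∀ i, Differentiable ℝ (deriv (f i)) := fun i =>
    (twiceDifferentiable_iff_deriv.1 (hf i).1).2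
  have hdu : ∀ i k, Differentiable ℝ (update f i (deriv (f i)) k) := fun i k => by
    rcases eq_or_ne k i with rfl | hk
    · simpa using hd2 k
    · simpa [hk] using hd k
  have hfd : fderiv ℝ (prodFun f) = fun x => ∑ i, prodFun (update f i (deriv (f i))) x •
      ContinuousLinearMap.proj (R := ℝ) (φ := fun _ : Fin n => ℝ) i :=
    funext fun x => (hasFDerivAt_prodFun hd x).fderiv
  have hdp : ∀ i, Differentiable ℝ (prodFun (update f i (deriv (f i)))) := fun i x =>
    (hasFDerivAt_prodFun (hdu i) x).differentiableAt
  have h1 : TwiceDifferentiable (prodFun f) := by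
    refine ⟨fun x => (hasFDerivAt_prodFun hd x).differentiableAt, ?_⟩
    rw [hfd]
    fun_prop
  have hf0 : ∀ i, MemLp (f i) (ENNReal.ofReal p) volume := fun i =>
    (hf i).1.continuous.memLp_of_hasCompactSupport (hf i).hasCompactSupport
  have hf1 : ∀ i, MemLp (deriv (f i)) (ENNReal.ofReal p) volume := fun i =>
    (hd2 i).continuous.memLp_of_hasCompactSupport (hf i).hasCompactSupport.deriv
  have hf2 : ∀ i, MemLp (deriv (deriv (f i))) (ENNReal.ofReal p) volume := fun i =>
    (isRegular_iff_deriv.1 (hf i)).2.2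
  refine ⟨h1, ?_, fun v w => ?_⟩
  · refine (Bornology.IsBounded.pi fun i => (hf i).2.1).subset fun x hx i _ => ?_
    exact Finset.prod_ne_zero_iff.1 hx i (Finset.mem_univ i)
  · obtain ⟨q, hq⟩ : ∃ q : Fin n → Fin n → (Fin n → ℝ) → ℝ, q = fun i k => prodFun (update (update f i (deriv (f i))) k
        (deriv (update f i (deriv (f i)) k))) := ⟨_, rfl⟩
    have h2 : (fun x => fderiv ℝ (fderiv ℝ (prodFun f)) x v w)
        = fun x => ∑ i, w i * ∑ k, v k * q i k x := by
      ext x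
      rw [← fderiv_fderiv_apply h1]
      simp_rw [fderiv_prodFun_apply hd]
      rw [fderiv_fun_sum fun i _ => ((hdp i) x).const_mul _]
      simp only [sum_apply]
      refine Finset.sum_congr rfl fun i _ => ?_
      rw [fderiv_const_mul ((hdp i) x), smul_apply,
        fderiv_prodFun_apply (hdu i), smul_eq_mul, hq]
    rw [h2]
    have h3 : ∀ i k, MemLp (q i k) (ENNReal.ofReal p) volume := fun i k => by
      rw [hq]
      refine memLp_prodFun hp fun j => ?_
      -- Factor `j` is differentiated twice only if `i = j = k`, the one case that needs the `L^p`
      -- hypothesis; otherwise it is continuous with compact support.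
      rcases eq_or_ne j k with rfl | hjk
      · rcases eq_or_ne j i with rfl | hji
        · simpa using hf2 j
        · simpa [hji] using hf1 j
      · rw [update_of_ne hjk]
        rcases eq_or_ne j i with rfl | hji
        · simpa using hf1 j
        · simpa [hji] using hf0 j
    have h4 : ∀ i, MemLp (fun x => ∑ k, v k * q i k x) (ENNReal.ofReal p) volume := fun i =>
      memLp_finsetSum _ fun k _ => (h3 i k).const_mul (v k)
    exact memLp_finsetSum _ fun i _ => (h4 i).const_mul (w i)

end Product

/-! ### Affine maps between product sets, and monomial matrices -/

section Box

variable {n : ℕ}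

/-- Choosing corners by the signs of row `i` maximizes and minimizes the `i`-th coordinate over the
box; both values must lie in the target interval. -/
theorem sum_abs_mul_le_of_mapsTo_box {M : Matrix (Fin n) (Fin n) ℝ} {b : Fin n → ℝ}
    {S T : Fin n → Set ℝ} {a₀ a₁ c₀ c₁ : Fin n → ℝ} (h₀ : ∀ j, a₀ j ∈ S j)
    (h₁ : ∀ j, a₁ j ∈ S j) (hT : ∀ i, T i ⊆ Icc (c₀ i) (c₁ i))
    (hmap : ∀ x ∈ univ.pi S, M *ᵥ x + b ∈ univ.pi T) (i : Fin n) :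
    ∑ j, |M i j| * (a₁ j - a₀ j) ≤ c₁ i - c₀ i := by
  classical
  set x : Fin n → ℝ := fun j => if 0 ≤ M i j then a₁ j else a₀ j with hx
  set x' : Fin n → ℝ := fun j => if 0 ≤ M i j then a₀ j else a₁ j with hx'
  have hxS : x ∈ univ.pi S := fun j _ => by
    simp only [hx]; split_ifs; exacts [h₁ j, h₀ j]
  have hxS' : x' ∈ univ.pi S := fun j _ => by
    simp only [hx']; split_ifs; exacts [h₀ j, h₁ j]
  have k1 := (hT i (hmap x hxS i (mem_univ i))).2
  have k2 := (hT i (hmap x' hxS' i (mem_univ i))).1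
  have k3 : ∑ j, |M i j| * (a₁ j - a₀ j) = (M *ᵥ x + b) i - (M *ᵥ x' + b) i := by
    simp only [Pi.add_apply, Matrix.mulVec, dotProduct, add_sub_add_right_eq_sub,
      ← Finset.sum_sub_distrib]
    refine Finset.sum_congr rfl fun j _ => ?_
    simp only [hx, hx']
    split_ifs with h
    · rw [abs_of_nonneg h]; ring
    · rw [abs_of_neg (not_le.1 h)]; ring
  linarith

/-- If nonnegative weights `α`, `γ` are almost preserved by `|M|` and by `|M⁻¹|`, then every row
of `M` has only one nonzero entry. -/
theorem eq_of_ne_zero_of_sum_abs_mul_le {M G : Matrix (Fin n) (Fin n) ℝ} (hMG : M * G = 1)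
    (hGM : G * M = 1) {α γ : Fin n → ℝ} (hα : ∀ j, 0 < α j)
    (h1 : ∀ i, ∑ j, |M i j| * α j ≤ γ i) (h2 : ∀ i, ∑ j, |G i j| * γ j ≤ α i)
    {k j j' : Fin n} (hj : M k j ≠ 0) (hj' : M k j' ≠ 0) : j = j' := by
  by_contra hne
  obtain ⟨i, hi⟩ : ∃ i, G i k ≠ 0 := by
    by_contra! h
    have := congrFun (congrFun hMG k) k
    simp [Matrix.mul_apply, h] at this
  -- Two nonzero entries in row `k` leave one outside column `i`; it makes the off-diagonal entry
  -- `(i, l)` of `|G| |M|` positive.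
  obtain ⟨l, hil, hl⟩ : ∃ l, i ≠ l ∧ M k l ≠ 0 := by
    by_cases h : i = j
    · exact ⟨j', h ▸ hne, hj'⟩
    · exact ⟨j, h, hj⟩
  have h3 : ∑ m, (∑ r, |G i r| * |M r m|) * α m ≤ α i := by
    calc ∑ m, (∑ r, |G i r| * |M r m|) * α m = ∑ r, |G i r| * ∑ m, |M r m| * α m := by
          simp_rw [Finset.sum_mul, Finset.mul_sum]
          rw [Finset.sum_comm]
          simp_rw [mul_assoc]
      _ ≤ ∑ r, |G i r| * γ r :=
          Finset.sum_le_sum fun r _ => mul_le_mul_of_nonneg_left (h1 r) (abs_nonneg _)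
      _ ≤ α i := h2 i
  have hnn : ∀ m, 0 ≤ ∑ r, |G i r| * |M r m| := fun m =>
    Finset.sum_nonneg fun r _ => by positivity
  have h4 : 1 ≤ ∑ r, |G i r| * |M r i| := by
    have h5 : ∑ r, G i r * M r i = 1 := by
      have := congrFun (congrFun hGM i) i
      simpa [Matrix.mul_apply] using this
    rw [← h5]
    exact Finset.sum_le_sum fun r _ => by rw [← abs_mul]; exact le_abs_self _
  have h6 : 0 < ∑ r, |G i r| * |M r l| := by
    refine Finset.sum_pos' (fun r _ => by positivity) ⟨k, Finset.mem_univ k, ?_⟩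
    have := abs_pos.2 hi
    have := abs_pos.2 hl
    positivity
  have h7 : (∑ r, |G i r| * |M r i|) * α i + (∑ r, |G i r| * |M r l|) * α l
      ≤ ∑ m, (∑ r, |G i r| * |M r m|) * α m := by
    rw [← Finset.sum_pair (f := fun m => (∑ r, |G i r| * |M r m|) * α m) hil]
    exact Finset.sum_le_sum_of_subset_of_nonneg (Finset.subset_univ _)
      fun m _ _ => mul_nonneg (hnn m) (hα m).le
  have h8 := mul_pos h6 (hα l)
  have h9 := mul_le_mul_of_nonneg_right h4 (hα i).le
  linarith

/-- An invertible affine map between products of bounded open subsets of the line has a linear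
part with only one nonzero entry in every row. -/
theorem eq_of_ne_zero_of_map_box {M G : Matrix (Fin n) (Fin n) ℝ} (hMG : M * G = 1)
    (hGM : G * M = 1) (b : Fin n → ℝ) {S T : Fin n → Set ℝ} (hS : ∀ i, IsOpen (S i))
    (hSn : ∀ i, (S i).Nonempty) (hSb : ∀ i, Bornology.IsBounded (S i))
    (hTb : ∀ i, Bornology.IsBounded (T i))
    (hST : ∀ x, M *ᵥ x + b ∈ univ.pi T ↔ x ∈ univ.pi S)
    {k j j' : Fin n} (hj : M k j ≠ 0) (hj' : M k j' ≠ 0) : j = j' := by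
  have hTn : ∀ i, (T i).Nonempty := by
    choose x hx using hSn
    exact fun i => ⟨_, (hST x).2 (fun i _ => hx i) i (mem_univ i)⟩
  have hext : ∀ S : Fin n → Set ℝ, (∀ i, (S i).Nonempty) → (∀ i, Bornology.IsBounded (S i)) →
      ∃ a₀ a₁ : Fin n → ℝ, ∀ i, IsLeast (closure (S i)) (a₀ i) ∧
        IsGreatest (closure (S i)) (a₁ i) := fun S hn hb => by
    choose a₀ ha₀ using fun i => (hb i).isCompact_closure.exists_isLeast (hn i).closure
    choose a₁ ha₁ using fun i => (hb i).isCompact_closure.exists_isGreatest (hn i).closure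
    exact ⟨a₀, a₁, fun i => ⟨ha₀ i, ha₁ i⟩⟩
  obtain ⟨a₀, a₁, ha⟩ := hext S hSn hSb
  obtain ⟨c₀, c₁, hc⟩ := hext T hTn hTb
  -- The extreme points lie only in the closures, so the inclusions are extended there by
  -- continuity.
  have hclos : ∀ (A : Matrix (Fin n) (Fin n) ℝ) (d : Fin n → ℝ) (U V : Fin n → Set ℝ),
      (∀ x ∈ univ.pi U, A *ᵥ x + d ∈ univ.pi V) →
      ∀ x ∈ univ.pi (fun i => closure (U i)), A *ᵥ x + d ∈ univ.pi (fun i => closure (V i)) :=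
    fun A d U V h x hx => by
      rw [← closure_pi_set] at hx ⊢
      have hcont : Continuous fun x : Fin n → ℝ => A *ᵥ x + d := by fun_prop
      exact map_mem_closure (f := fun x => A *ᵥ x + d) hcont hx h
  have hinv : ∀ x ∈ univ.pi T, G *ᵥ x + -(G *ᵥ b) ∈ univ.pi S := fun x hx => by
    rw [← hST, Matrix.mulVec_add, Matrix.mulVec_neg, Matrix.mulVec_mulVec, Matrix.mulVec_mulVec,
      hMG]
    simpa using hx
  refine eq_of_ne_zero_of_sum_abs_mul_le hMG hGM (α := fun i => a₁ i - a₀ i)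
    (γ := fun i => c₁ i - c₀ i) (fun i => ?_) (fun i => ?_) (fun i => ?_) hj hj'
  · obtain ⟨x, hx⟩ := hSn i
    -- Openness provides a point of `S i` strictly to the left of `x`, so the width is positive.
    obtain ⟨y, hy, hyS⟩ := ((hS i).mem_nhds hx |> mem_nhds_iff_exists_Ioo_subset.1 : ∃ l u, _)
    have h1 : x ≤ a₁ i := (ha i).2.2 (subset_closure hx)
    have h2 : (y + x) / 2 ∈ S i := hyS.2 ⟨by linarith [hyS.1.1], by linarith [hyS.1.1, hyS.1.2]⟩
    have h3 : a₀ i ≤ (y + x) / 2 := (ha i).1.2 (subset_closure h2)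
    linarith [hyS.1.1]
  · exact sum_abs_mul_le_of_mapsTo_box (fun j => (ha j).1.1) (fun j => (ha j).2.1)
      (fun i t ht => ⟨(hc i).1.2 ht, (hc i).2.2 ht⟩)
      (hclos M b S T fun x hx => (hST x).2 hx) i
  · exact sum_abs_mul_le_of_mapsTo_box (fun j => (hc j).1.1) (fun j => (hc j).2.1)
      (fun i t ht => ⟨(ha i).1.2 ht, (ha i).2.2 ht⟩) (hclos G _ T S hinv) i

/-- Invertibility excludes zero rows and columns, so sending a row to its nonzero column is
surjective, hence a permutation. -/
theorem mem_trivialFilters_of_row {M : Matrix (Fin n) (Fin n) ℝ} (hM : M ∈ linearFilters n)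
    (hrow : ∀ k j j', M k j ≠ 0 → M k j' ≠ 0 → j = j') : M ∈ trivialFilters n := by
  have hu : IsUnit M.det := hM
  have hr : ∀ k, ∃ j, M k j ≠ 0 := fun k => by
    by_contra! h
    have := congrFun (congrFun (Matrix.mul_nonsing_inv M hu) k) k
    simp [Matrix.mul_apply, h] at this
  have hc : ∀ j, ∃ k, M k j ≠ 0 := fun j => by
    by_contra! h
    have := congrFun (congrFun (Matrix.nonsing_inv_mul M hu) j) j
    simp [Matrix.mul_apply, h] at this
  choose τ hτ using hr
  have hsurj : Surjective τ := fun j => by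
    obtain ⟨k, hk⟩ := hc j
    exact ⟨k, hrow k _ _ (hτ k) hk⟩
  obtain ⟨e, he⟩ : ∃ e : Equiv.Perm (Fin n), ∀ k, e k = τ k :=
    ⟨Equiv.ofBijective τ ⟨Finite.injective_iff_surjective.2 hsurj, hsurj⟩, fun _ => rfl⟩
  -- The diagonal factor stands on the right and scales columns, so it is indexed by the column.
  refine ⟨e, fun j => M (e.symm j) j, fun j => ?_, ?_⟩
  · have := hτ (e.symm j)
    rwa [← he, e.apply_symm_apply] at this
  · ext i j
    rw [Matrix.mul_diagonal, Equiv.Perm.permMatrix, Equiv.toPEquiv, PEquiv.toMatrix_apply]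
    by_cases h : e i = j
    · subst h; simp
    · have : M i j = 0 := by
        by_contra h0
        exact h ((he i).trans (hrow i _ _ (hτ i) h0))
      simp [this, h]

theorem trivialFilters_subset_linearFilters : trivialFilters n ⊆ linearFilters n := by
  rintro _ ⟨σ, d, hd, rfl⟩
  change IsUnit _
  rw [Matrix.det_mul, Matrix.det_permutation, Matrix.det_diagonal, isUnit_iff_ne_zero]
  refine mul_ne_zero ?_ (Finset.prod_ne_zero_iff.2 fun i _ => hd i)
  simp

end Box

/-! ### Affine maps of the line -/

section Real

theorem IsPDF.map_mul_add {ν : Measure ℝ} {f : ℝ → ℝ} (hf : IsPDF ν f) {c : ℝ} (hc : c ≠ 0)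
    (b : ℝ) : IsPDF (ν.map fun t => c * t + b) (fun t => |c⁻¹| * f (c⁻¹ * (t - b))) := by
  have h := hf.map_affine (ContinuousLinearEquiv.smulLeft (Units.mk0 c hc)) b
  have hdet : LinearMap.det ((ContinuousLinearEquiv.smulLeft (R₁ := ℝ) (M₁ := ℝ) (Units.mk0 c hc) :
      ℝ ≃L[ℝ] ℝ) : ℝ →ₗ[ℝ] ℝ) = c := by
    rw [LinearMap.det_ring]; simp [ContinuousLinearEquiv.smulLeft, Units.smul_def]
  rw [hdet] at h
  exact h

theorem IsRegular.mul_add {p : ℝ} {f : ℝ → ℝ} (hf : IsRegular p f) {c : ℝ} (hc : c ≠ 0)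
    (b : ℝ) : IsRegular p (fun t => |c⁻¹| * f (c⁻¹ * (t - b))) :=
  hf.comp_affine (ContinuousLinearEquiv.smulLeft (Units.mk0 c hc)⁻¹) b |c⁻¹|

theorem exists_isRegular_map_mul_add {p : ℝ} {ν : Measure ℝ}
    (h : ∃ f, IsPDF ν f ∧ IsRegular p f) {c : ℝ} (hc : c ≠ 0) (b : ℝ) :
    ∃ f, IsPDF (ν.map fun t => c * t + b) f ∧ IsRegular p f := by
  obtain ⟨f, h1, h2⟩ := h
  exact ⟨_, h1.map_mul_add hc b, h2.mul_add hc b⟩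

end Real

/-! ### Variances and linear combinations of the sources -/

section Random

variable {Ω : Type*} [MeasurableSpace Ω] {P : Measure Ω} [IsProbabilityMeasure P] {n : ℕ}

/-- Bounded support makes `X` square integrable; zero variance would then concentrate its law at the
mean, a null set for a law with density. This keeps normalization from dividing by zero. -/
theorem variance_ne_zero_of_isPDF {X : Ω → ℝ} (hX : Measurable X) {f : ℝ → ℝ}
    (hf : IsPDF (P.map X) f) (hb : Bornology.IsBounded (support f)) : variance X P ≠ 0 := by
  intro h0
  have hnull : ∀ s : Set ℝ, MeasurableSet s → (∀ᵐ t, t ∈ s → f t = 0) → ∀ᵐ ω ∂P, X ω ∉ s := by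
    intro s hs h
    have h1 : P.map X s = 0 := by
      rw [hf.2.2, withDensity_apply _ hs, lintegral_eq_zero_iff (by have := hf.1; fun_prop)]
      refine (ae_restrict_iff' hs).2 (h.mono fun t ht hts => ?_)
      simp [ht hts]
    rw [Measure.map_apply hX hs] at h1
    exact measure_eq_zero_iff_ae_notMem.1 h1
  obtain ⟨r, hr⟩ := hb.subset_closedBall 0
  have hbd : ∀ᵐ ω ∂P, ‖X ω‖ ≤ r := by
    refine (hnull (Metric.closedBall 0 r)ᶜ Metric.isClosed_closedBall.measurableSet.compl
      (Filter.Eventually.of_forall fun t ht => ?_)).mono fun ω hω => ?_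
    · exact notMem_support.1 fun hh => ht (hr hh)
    · simpa using hω
  have hL : MemLp X 2 P := MemLp.of_bound hX.aestronglyMeasurable r hbd
  have hae := ae_eq_integral_of_variance_eq_zero hL h0
  have hne : ∀ᵐ ω ∂P, X ω ∉ ({∫ x, X x ∂P} : Set ℝ) :=
    hnull _ (measurableSet_singleton _) ((measure_eq_zero_iff_ae_notMem.1
      (Real.volume_singleton (a := ∫ x, X x ∂P))).mono fun t ht hh => absurd hh ht)
  obtain ⟨ω, h1, h2⟩ := (hae.and hne).exists
  exact h2 h1

/-- A nonzero linear combination of independent random variables with regular densities has a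
regular density. -/
theorem exists_isRegular_sum {p : ℝ} {s : Ω → Fin n → ℝ} (hm : Measurable s)
    (hi : iIndepFun (fun i ω => s ω i) P)
    (hf : ∀ i, ∃ f, IsPDF (P.map fun ω => s ω i) f ∧ IsRegular p f) (a : Fin n → ℝ)
    (A : Finset (Fin n)) :
    (∀ j ∈ A, a j = 0) ∨
      ∃ g, IsPDF (P.map fun ω => ∑ j ∈ A, a j * s ω j) g ∧ IsRegular p g := by
  have hms : ∀ i, Measurable fun ω => s ω i := fun i => (measurable_pi_apply i).comp hm
  -- The case of vanishing coefficients must be carried along: the partial sum is then zero and has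
  -- no density.
  induction A using Finset.induction_on with
  | empty => simp
  | insert k A hk ih =>
    by_cases hak : a k = 0
    · simpa [Finset.sum_insert hk, hak] using ih
    · right
      have hk1 : ∃ g, IsPDF (P.map fun ω => a k * s ω k) g ∧ IsRegular p g := by
        have := exists_isRegular_map_mul_add (hf k) hak 0
        rw [Measure.map_map (by fun_prop) (hms k)] at this
        simpa [Function.comp_def] using this
      rcases ih with ih | ih
      · have : ∀ ω, ∑ j ∈ insert k A, a j * s ω j = a k * s ω k := fun ω => by
          rw [Finset.sum_insert hk, Finset.sum_eq_zero fun j hj => by rw [ih j hj, zero_mul],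
            add_zero]
        simpa [this] using hk1
      · obtain ⟨f, hf1, hf2⟩ := ih
        obtain ⟨g, hg1, hg2⟩ := hk1
        have hind : IndepFun (fun ω => ∑ j ∈ A, a j * s ω j) (fun ω => a k * s ω k) P := by
          have h1 : iIndepFun (fun i ω => a i * s ω i) P :=
            hi.comp (fun i t => a i * t) fun i => by fun_prop
          have h2 := h1.indepFun_finsetSum_of_notMem (fun i => (hms i).const_mul _) hk
          convert h2 using 1
          ext ω; simp
        refine ⟨_, ?_, hf2.convolution hg2 p⟩
        have h3 := hf1.conv hg1 hf2.1.continuous hg2.1.continuous hf2.hasCompactSupport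
        rw [← hind.map_add_eq_map_conv_map
          (Finset.measurable_fun_sum _ fun j _ => (hms j).const_mul _) ((hms k).const_mul _)] at h3
        have h4 : (fun ω => ∑ j ∈ insert k A, a j * s ω j)
            = (fun ω => ∑ j ∈ A, a j * s ω j) + fun ω => a k * s ω k := by
          ext ω; simp [Finset.sum_insert hk, add_comm]
        rwa [h4]

end Random

/-! ### Invertible matrices as linear equivalences -/

section Matrix

variable {n : ℕ}

/-- Multiplication by an invertible matrix as a continuous linear equivalence. -/
noncomputable def mulVecEquiv {M G : Matrix (Fin n) (Fin n) ℝ} (hMG : M * G = 1) (hGM : G * M = 1) :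
    (Fin n → ℝ) ≃L[ℝ] (Fin n → ℝ) :=
  (Matrix.toLin'OfInv hGM hMG).toContinuousLinearEquiv

theorem mulVecEquiv_apply {M G : Matrix (Fin n) (Fin n) ℝ} (hMG : M * G = 1) (hGM : G * M = 1)
    (x : Fin n → ℝ) : mulVecEquiv hMG hGM x = M *ᵥ x := by
  simp [mulVecEquiv, Matrix.toLin'OfInv]

theorem mulVecEquiv_symm_apply {M G : Matrix (Fin n) (Fin n) ℝ} (hMG : M * G = 1)
    (hGM : G * M = 1) (x : Fin n → ℝ) : (mulVecEquiv hMG hGM).symm x = G *ᵥ x := by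
  rw [ContinuousLinearEquiv.symm_apply_eq, mulVecEquiv_apply, Matrix.mulVec_mulVec, hMG,
    Matrix.one_mulVec]

theorem det_mulVecEquiv {M G : Matrix (Fin n) (Fin n) ℝ} (hMG : M * G = 1) (hGM : G * M = 1) :
    LinearMap.det ((mulVecEquiv hMG hGM : (Fin n → ℝ) ≃L[ℝ] (Fin n → ℝ)) :
      (Fin n → ℝ) →ₗ[ℝ] (Fin n → ℝ)) = M.det := by
  rw [← LinearMap.det_toLin']
  congr 1

theorem hessian_apply {f : (Fin n → ℝ) → ℝ} (hf : TwiceDifferentiable f) (x : Fin n → ℝ)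
    (i j : Fin n) :
    hessian f x i j = fderiv ℝ (fderiv ℝ f) x (Pi.single i 1) (Pi.single j 1) :=
  fderiv_fderiv_apply hf _ _ _

end Matrix

/-! ### The HFD of a mixture law -/

section MixtureLaw

variable {n : ℕ}

/-- `ν` has the joint density of `M s + b`, where `s` has independent components with regular
densities `f i`, and its marginals have regular densities `g i`. -/
structure IsMixtureLaw (p : ℝ) (ν : Measure (Fin n → ℝ)) (M G : Matrix (Fin n) (Fin n) ℝ)
    (b : Fin n → ℝ) (f g : Fin n → ℝ → ℝ) : Prop where
  mul_inv : M * G = 1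
  inv_mul : G * M = 1
  source : ∀ i, IsRegular p (f i)
  source_nonempty : ∀ i, (support (f i)).Nonempty
  marginal : ∀ i, IsRegular p (g i)
  isPDF_joint : IsPDF ν fun y => |M.det⁻¹| * prodFun f (G *ᵥ (y - b))
  isPDF_marginal : ∀ i, IsPDF (ν.map fun z : Fin n → ℝ => z i) (g i)

variable {p : ℝ} {ν : Measure (Fin n → ℝ)} {M G : Matrix (Fin n) (Fin n) ℝ} {b : Fin n → ℝ}
  {f g : Fin n → ℝ → ℝ}

theorem IsMixtureLaw.isRegular_joint (h : IsMixtureLaw p ν M G b f g) (hp : 1 ≤ p) :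
    IsRegular p fun y => |M.det⁻¹| * prodFun f (G *ᵥ (y - b)) := by
  have := (isRegular_prodFun hp h.source).comp_affine (mulVecEquiv h.inv_mul h.mul_inv) b |M.det⁻¹|
  simpa only [mulVecEquiv_apply] using this

theorem IsMixtureLaw.pdfOf_joint (h : IsMixtureLaw p ν M G b f g) (hp : 1 ≤ p) :
    pdfOf ν = fun y => |M.det⁻¹| * prodFun f (G *ᵥ (y - b)) :=
  pdfOf_eq h.isPDF_joint (h.isRegular_joint hp).1.continuous

theorem IsMixtureLaw.pdfOf_marginal (h : IsMixtureLaw p ν M G b f g) (i : Fin n) :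
    pdfOf (ν.map fun z : Fin n → ℝ => z i) = g i :=
  pdfOf_eq (h.isPDF_marginal i) (h.marginal i).1.continuous

theorem IsMixtureLaw.prodMarginalPDF_eq (h : IsMixtureLaw p ν M G b f g) :
    prodMarginalPDF ν = prodFun g := by
  ext x
  simp only [prodMarginalPDF, prodFun, h.pdfOf_marginal]

theorem IsMixtureLaw.isRegular_pdfOf (h : IsMixtureLaw p ν M G b f g) (hp : 1 ≤ p) :
    IsRegular p (pdfOf ν) := h.pdfOf_joint hp ▸ h.isRegular_joint hp

theorem IsMixtureLaw.isRegular_prodMarginalPDF (h : IsMixtureLaw p ν M G b f g) (hp : 1 ≤ p) :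
    IsRegular p (prodMarginalPDF ν) := h.prodMarginalPDF_eq ▸ isRegular_prodFun hp h.marginal

theorem IsMixtureLaw.hfd_apply (h : IsMixtureLaw p ν M G b f g) (hp : 1 ≤ p) (x : Fin n → ℝ)
    (i j : Fin n) : HFD ν x i j
      = fderiv ℝ (fderiv ℝ (prodMarginalPDF ν)) x (Pi.single i 1) (Pi.single j 1)
        - fderiv ℝ (fderiv ℝ (pdfOf ν)) x (Pi.single i 1) (Pi.single j 1) := by
  rw [HFD, Matrix.sub_apply, hessian_apply (h.isRegular_prodMarginalPDF hp).1,
    hessian_apply (h.isRegular_pdfOf hp).1]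

theorem IsMixtureLaw.memLp_hfd (h : IsMixtureLaw p ν M G b f g) (hp : 1 ≤ p) (i j : Fin n) :
    MemLp (fun x => HFD ν x i j) (ENNReal.ofReal p) volume := by
  simp_rw [h.hfd_apply hp]
  exact ((h.isRegular_prodMarginalPDF hp).2.2 _ _).sub ((h.isRegular_pdfOf hp).2.2 _ _)

theorem IsMixtureLaw.hasRegularPDF (h : IsMixtureLaw p ν M G b f g) (hp : 1 ≤ p) :
    HasRegularPDF ν :=
  ⟨_, h.isPDF_joint, (h.isRegular_joint hp).1, (h.isRegular_joint hp).2.1⟩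

theorem IsMixtureLaw.hasRegularPDF_marginal (h : IsMixtureLaw p ν M G b f g) (i : Fin n) :
    HasRegularPDF (ν.map fun z : Fin n → ℝ => z i) :=
  ⟨_, h.isPDF_marginal i, (h.marginal i).1, (h.marginal i).2.1⟩

theorem hfdNorm_nonneg (p : ℝ) (ν : Measure (Fin n → ℝ)) : 0 ≤ hfdNorm p ν :=
  Real.rpow_nonneg (Finset.sum_nonneg fun _ _ => Finset.sum_nonneg fun _ _ =>
    integral_nonneg fun _ => Real.rpow_nonneg (abs_nonneg _) _) _

theorem IsMixtureLaw.ae_hfd_eq_zero (h : IsMixtureLaw p ν M G b f g) (hp : 1 ≤ p)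
    (h0 : hfdNorm p ν = 0) (i j : Fin n) : ∀ᵐ x, HFD ν x i j = 0 := by
  have hp0 : p ≠ 0 := by linarith
  have hnn : ∀ i j, 0 ≤ ∫ x, |HFD ν x i j| ^ p := fun i j =>
    integral_nonneg fun _ => Real.rpow_nonneg (abs_nonneg _) _
  have h1 : ∑ i, ∑ j, ∫ x, |HFD ν x i j| ^ p = 0 :=
    (Real.rpow_eq_zero (Finset.sum_nonneg fun i _ => Finset.sum_nonneg fun j _ => hnn i j)
      (by positivity)).1 h0
  have h2 := (Finset.sum_eq_zero_iff_of_nonneg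
    fun i _ => Finset.sum_nonneg fun j _ => hnn i j).1 h1 i (Finset.mem_univ i)
  have h3 := (Finset.sum_eq_zero_iff_of_nonneg fun j _ => hnn i j).1 h2 j (Finset.mem_univ j)
  have hint : Integrable fun x => |HFD ν x i j| ^ p := by
    have := (h.memLp_hfd hp i j).integrable_norm_rpow (by simp; linarith) ENNReal.ofReal_ne_top
    rwa [ENNReal.toReal_ofReal (by linarith)] at this
  rw [integral_eq_zero_iff_of_nonneg (fun _ => Real.rpow_nonneg (abs_nonneg _) _) hint] at h3
  filter_upwards [h3] with x hx
  exact abs_eq_zero.1 ((Real.rpow_eq_zero (abs_nonneg _) hp0).1 hx)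

/-- A vanishing HFD forces the joint density to be the product of its marginals; equating the
nonvanishing sets gives an affine map between product sets. -/
theorem IsMixtureLaw.row_of_hfdNorm_eq_zero (h : IsMixtureLaw p ν M G b f g) (hp : 1 ≤ p)
    (h0 : hfdNorm p ν = 0) {k j j' : Fin n} (hj : M k j ≠ 0) (hj' : M k j' ≠ 0) : j = j' := by
  have hr1 := h.isRegular_prodMarginalPDF hp
  have hr2 := h.isRegular_pdfOf hp
  have hb : Bornology.IsBounded (support fun x => prodMarginalPDF ν x - pdfOf ν x) :=
    (hr1.2.1.union hr2.2.1).subset (support_sub _ _)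
  have hD : ∀ x, prodMarginalPDF ν x - pdfOf ν x = 0 := by
    -- A single diagonal entry of the HFD, the one at `(k, k)`, is enough.
    refine eq_zero_of_ae_fderiv_fderiv_eq_zero (hr1.1.sub hr2.1) hb
      (v := Pi.single k 1) (by simp) ?_
    filter_upwards [h.ae_hfd_eq_zero hp h0 k k] with x hx
    rw [h.hfd_apply hp] at hx
    rw [fderiv_fderiv_sub hr1.1 hr2.1]
    exact hx
  have hdet : |M.det⁻¹| ≠ 0 := by
    have : IsUnit M.det := (Matrix.isUnit_iff_isUnit_det M).1 ⟨⟨M, G, h.mul_inv, h.inv_mul⟩, rfl⟩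
    exact abs_ne_zero.2 (inv_ne_zero this.ne_zero)
  have hsupp : ∀ (q : Fin n → ℝ → ℝ) x, prodFun q x ≠ 0 ↔ x ∈ univ.pi fun i => support (q i) := by
    intro q x
    simp [prodFun, Finset.prod_ne_zero_iff]
  refine eq_of_ne_zero_of_map_box h.mul_inv h.inv_mul b (S := fun i => support (f i))
    (T := fun i => support (g i))
    (fun i => (h.source i).1.continuous.isOpen_support) h.source_nonempty
    (fun i => (h.source i).2.1) (fun i => (h.marginal i).2.1) (fun x => ?_) hj hj'
  rw [← hsupp, ← hsupp, ← h.prodMarginalPDF_eq, sub_eq_zero.1 (hD _), h.pdfOf_joint hp]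
  simp only [add_sub_cancel_right, Matrix.mulVec_mulVec, h.inv_mul, Matrix.one_mulVec]
  rw [mul_ne_zero_iff]
  exact and_iff_right hdet

/-- Under independence the product of the marginal densities is a continuous joint density, and such
a density is unique. -/
theorem hfdNorm_eq_zero_of_pi [IsProbabilityMeasure ν] (h : IsMixtureLaw p ν M G b f g)
    (hp : 1 ≤ p) (hi : ν = Measure.pi fun i => ν.map fun z : Fin n → ℝ => z i) :
    hfdNorm p ν = 0 := by
  have : ∀ i, IsProbabilityMeasure (ν.map fun z : Fin n → ℝ => z i) := fun i =>
    Measure.isProbabilityMeasure_map (measurable_pi_apply i).aemeasurable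
  have h1 : IsPDF ν (prodFun g) := by
    have := isPDF_prodFun h.isPDF_marginal
    rwa [← hi] at this
  have h2 : pdfOf ν = prodFun g := pdfOf_eq h1 (isRegular_prodFun hp h.marginal).1.continuous
  have h3 : ∀ x i j, HFD ν x i j = 0 := fun x i j => by
    rw [HFD, h.prodMarginalPDF_eq, h2, sub_self, Matrix.zero_apply]
  have hp0 : p ≠ 0 := by linarith
  simp [hfdNorm, h3, Real.zero_rpow hp0, Real.zero_rpow (inv_ne_zero hp0)]

/-- The entrywise norm is invariant under signed permutations of the coordinates. -/
theorem IsMixtureLaw.hfdNorm_map_signedPerm (h : IsMixtureLaw p ν M G b f g) (hp : 1 ≤ p)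
    (σ : Equiv.Perm (Fin n)) {ε : Fin n → ℝ} (hε : ∀ i, |ε i| = 1) :
    hfdNorm p (ν.map fun z i => ε i * z (σ i)) = hfdNorm p ν := by
  have hε2 : ∀ i, ε i * ε i = 1 := fun i => by rw [← abs_mul_abs_self, hε, one_mul]
  have hε0 : ∀ i, ε i ≠ 0 := fun i => left_ne_zero_of_mul_eq_one (hε2 i)
  have hεi : ∀ i, (ε i)⁻¹ = ε i := fun i => inv_eq_of_mul_eq_one_left (hε2 i)
  set Q : Matrix (Fin n) (Fin n) ℝ := Matrix.diagonal ε * σ.permMatrix ℝ with hQ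
  set R : Matrix (Fin n) (Fin n) ℝ := σ⁻¹.permMatrix ℝ * Matrix.diagonal ε with hR
  have hQv : ∀ z i, (Q *ᵥ z) i = ε i * z (σ i) := fun z i => by
    rw [hQ, ← Matrix.mulVec_mulVec, Matrix.mulVec_diagonal, Matrix.permMatrix_mulVec]
    rfl
  have hRv : ∀ z i, (R *ᵥ z) i = ε (σ⁻¹ i) * z (σ⁻¹ i) := fun z i => by
    rw [hR, ← Matrix.mulVec_mulVec, Matrix.permMatrix_mulVec]
    exact Matrix.mulVec_diagonal _ _ _
  have hQR : Q * R = 1 := by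
    refine Matrix.toLin'.injective (LinearMap.ext fun z => ?_)
    ext i
    rw [Matrix.toLin'_apply, Matrix.toLin'_apply, ← Matrix.mulVec_mulVec, hQv, hRv, Matrix.one_mulVec]
    simp [← mul_assoc, hε2]
  have hRQ : R * Q = 1 := mul_eq_one_comm.1 hQR
  have hdetR : |R.det| = 1 := by
    rw [hR, Matrix.det_mul, Matrix.det_permutation, Matrix.det_diagonal, abs_mul,
      Finset.abs_prod, Finset.prod_congr rfl fun i _ => hε i]
    rcases Int.units_eq_one_or (Equiv.Perm.sign σ⁻¹) with h | h <;> rw [h] <;> simp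
  have hdetQ : |Q.det| = 1 := by
    have := congrArg (fun A => |Matrix.det A|) hQR
    simpa [Matrix.det_mul, abs_mul, hdetR] using this
  have hQfun : (fun z : Fin n → ℝ => fun i => ε i * z (σ i)) = fun z => Q *ᵥ z := by
    ext z i; exact (hQv z i).symm
  set ν' := ν.map fun z : Fin n → ℝ => fun i => ε i * z (σ i) with hν'
  -- the joint density
  have hF := h.isRegular_pdfOf hp
  have hFp : IsPDF ν (pdfOf ν) := by rw [h.pdfOf_joint hp]; exact h.isPDF_joint
  -- The factor `1` and shift `0` match the general affine form, so that one Hessian formula serves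
  -- both densities.
  have hjoint : pdfOf ν' = fun x => 1 * pdfOf ν (R *ᵥ (x - 0)) := by
    have h1 := hFp.map_affine (mulVecEquiv hQR hRQ) 0
    have h2 := hF.comp_affine (mulVecEquiv hRQ hQR) 0 1
    simp only [mulVecEquiv_apply, mulVecEquiv_symm_apply, det_mulVecEquiv, abs_inv, hdetQ, inv_one,
      add_zero, ← hQfun] at h1 h2
    exact pdfOf_eq h1 h2.1.continuous
  have hmarg : ∀ i, pdfOf (ν'.map fun z : Fin n → ℝ => z i) = fun t => g (σ i) (ε i * t) := by
    intro i
    have h1 := (h.isPDF_marginal (σ i)).map_mul_add (hε0 i) 0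
    have h2 := (h.marginal (σ i)).mul_add (hε0 i) 0
    rw [Measure.map_map (by fun_prop) (by fun_prop)] at h1
    simp only [hεi, hε, one_mul, sub_zero, add_zero] at h1 h2
    rw [hν', Measure.map_map (by fun_prop) (by fun_prop)]
    exact pdfOf_eq h1 h2.1.continuous
  have hprod : prodMarginalPDF ν' = fun x => 1 * prodMarginalPDF ν (R *ᵥ (x - 0)) := by
    ext x
    simp only [prodMarginalPDF, hmarg, h.pdfOf_marginal, one_mul, sub_zero, hRv]
    conv_rhs => rw [← Equiv.prod_comp σ]
    simp
  -- Since `R` sends `e_i` to `ε_i e_{σ i}`, bilinearity permutes the Hessian entries and changes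
  -- them only by signs.
  have hess : ∀ F : (Fin n → ℝ) → ℝ, TwiceDifferentiable F → ∀ x i j,
      hessian (fun x => 1 * F (R *ᵥ (x - 0))) x i j
        = ε i * ε j * hessian F (R *ᵥ x) (σ i) (σ j) := by
    intro F hF x i j
    obtain ⟨h1, h2⟩ := fderiv_fderiv_comp_affine hF
      (mulVecEquiv hRQ hQR : (Fin n → ℝ) →L[ℝ] (Fin n → ℝ)) 0 1
    have hs : ∀ i, R *ᵥ (Pi.single i 1) = ε i • (Pi.single (σ i) 1 : Fin n → ℝ) := by
      intro i; ext k
      rw [hRv]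
      by_cases hk : k = σ i
      · subst hk; simp
      · have : σ⁻¹ k ≠ i := fun hh => hk (by rw [← hh]; simp)
        rw [Pi.single_eq_of_ne this, Pi.smul_apply, Pi.single_eq_of_ne hk]
        simp
    simp only [ContinuousLinearEquiv.coe_coe, mulVecEquiv_apply] at h1 h2
    rw [hessian_apply h1, h2, hessian_apply hF, hs, hs]
    simp only [sub_zero, one_mul, map_smul, smul_apply, smul_eq_mul]
    ring
  have hHFD : ∀ x i j, |HFD ν' x i j| = |HFD ν (R *ᵥ x) (σ i) (σ j)| := by
    intro x i j
    rw [HFD, HFD, hprod, hjoint, Matrix.sub_apply, Matrix.sub_apply, hess _ hF.1,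
      hess _ (h.isRegular_prodMarginalPDF hp).1, ← mul_sub, abs_mul, abs_mul, hε, hε]
    simp
  -- `|det R| = 1`, so substituting `R x` does not change the integrals.
  have hmp : MeasurePreserving (mulVecEquiv hRQ hQR).toHomeomorph.toMeasurableEquiv
      (volume : Measure (Fin n → ℝ)) volume := by
    refine ⟨(mulVecEquiv hRQ hQR).continuous.measurable, ?_⟩
    have := map_volume_affine (mulVecEquiv hRQ hQR) 0
    simp only [det_mulVecEquiv, abs_inv, hdetR, inv_one, add_zero, ENNReal.ofReal_one,
      one_smul] at this
    exact this
  unfold hfdNorm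
  congr 1
  have hint : ∀ i j, ∫ x, |HFD ν' x i j| ^ p = ∫ x, |HFD ν x (σ i) (σ j)| ^ p := by
    intro i j
    simp_rw [hHFD]
    exact hmp.integral_comp' (fun x => |HFD ν x (σ i) (σ j)| ^ p)
  simp_rw [hint]
  rw [Equiv.sum_comp σ fun i => ∑ j, ∫ x, |HFD ν x i (σ j)| ^ p]
  exact Finset.sum_congr rfl fun i _ => Equiv.sum_comp σ fun j => ∫ x, |HFD ν x i j| ^ p

end MixtureLaw

/-! ### Normalized mixtures and the contrast properties -/

section Mixtures

variable {Ω : Type*} [MeasurableSpace Ω] {P : Measure Ω} {n : ℕ} {p : ℝ}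

theorem exists_isRegular_of_mem_sources {s : Ω → Fin n → ℝ} (hs : s ∈ sources P n p) (i : Fin n) :
    ∃ f, IsPDF (P.map fun ω => s ω i) f ∧ IsRegular p f := by
  obtain ⟨f, h1, h2⟩ := hs.2.2 i
  exact ⟨f, h1, isRegular_iff_deriv.2 h2⟩

theorem measurable_act (H : Matrix (Fin n) (Fin n) ℝ) {x : Ω → Fin n → ℝ} (hx : Measurable x) :
    Measurable (act H x) := by
  have : Measurable fun v : Fin n → ℝ => H *ᵥ v := by
    have : Continuous fun v : Fin n → ℝ => H *ᵥ v := by fun_prop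
    exact this.measurable
  exact this.comp hx

theorem measurable_of_mem_mixtures {x : Ω → Fin n → ℝ}
    (hx : x ∈ mixtures (linearFilters n) (sources P n p)) : Measurable x := by
  obtain ⟨H, -, s, hs, rfl⟩ := hx
  exact measurable_act H hs.1

theorem act_one {Ω : Type*} (x : Ω → Fin n → ℝ) : act 1 x = x := by
  ext1 ω; simp [act]

theorem one_mem_linearFilters : (1 : Matrix (Fin n) (Fin n) ℝ) ∈ linearFilters n := by
  simp [linearFilters]

theorem mem_mixtures_of_mem_sources {s : Ω → Fin n → ℝ} (hs : s ∈ sources P n p) :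
    s ∈ mixtures (linearFilters n) (sources P n p) :=
  ⟨1, one_mem_linearFilters, s, hs, (act_one s).symm⟩

theorem measurable_normalize (P : Measure Ω) {y : Ω → Fin n → ℝ} (hy : Measurable y) :
    Measurable (normalize P y) := by
  unfold normalize
  fun_prop

/-- The law of the normalized vector is a function of the law of the vector. -/
theorem map_normalize {y : Ω → Fin n → ℝ} (hy : Measurable y) :
    P.map (normalize P y) = (P.map y).map (normalize (P.map y) id) := by
  rw [Measure.map_map (measurable_normalize _ measurable_id) hy]
  congr 1
  ext ω i
  have hi : Measurable fun v : Fin n → ℝ => v i := measurable_pi_apply i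
  simp only [normalize, Function.comp_apply, id]
  rw [integral_map hy.aemeasurable hi.aestronglyMeasurable,
    variance_map hi.aemeasurable hy.aemeasurable]
  rfl

theorem map_act (H : Matrix (Fin n) (Fin n) ℝ) {x : Ω → Fin n → ℝ} (hx : Measurable x) :
    P.map (act H x) = (P.map x).map fun v => H *ᵥ v :=
  (Measure.map_map (g := fun v : Fin n → ℝ => H *ᵥ v) (measurable_act H measurable_id)
    hx).symm

theorem hfdCriterion_eq_of_map_eq (H : Matrix (Fin n) (Fin n) ℝ) {x x' : Ω → Fin n → ℝ}
    (hx : Measurable x) (hx' : Measurable x') (h : P.map x = P.map x') :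
    hfdCriterion P p H x = hfdCriterion P p H x' := by
  rw [hfdCriterion, hfdCriterion, hfdMeasure, hfdMeasure, map_normalize (measurable_act H hx),
    map_normalize (measurable_act H hx'), map_act H hx, map_act H hx', h]

/-- Normalization is a diagonal affine map, so `M` is `H` with rows rescaled by nonzero factors; the
last clause lets the zero pattern found for `M` be read off for `H`. -/
theorem exists_isMixtureLaw [IsProbabilityMeasure P] {s : Ω → Fin n → ℝ} (hs : s ∈ sources P n p)
    {H : Matrix (Fin n) (Fin n) ℝ} (hH : H ∈ linearFilters n) :
    ∃ M G b f g, IsMixtureLaw p (P.map (normalize P (act H s))) M G b f g ∧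
      ∀ k j, H k j ≠ 0 → M k j ≠ 0 := by
  have hu : IsUnit H.det := hH
  have hms := hs.1
  have hmsi : ∀ i, Measurable fun ω => s ω i := fun i => (measurable_pi_apply i).comp hms
  have hy := measurable_act H hms
  have hyi : ∀ i, Measurable fun ω => act H s ω i := fun i => (measurable_pi_apply i).comp hy
  choose f hf hfr using exists_isRegular_of_mem_sources hs
  have hlin : ∀ i, ∃ g, IsPDF (P.map fun ω => act H s ω i) g ∧ IsRegular p g := fun i => by
    refine (exists_isRegular_sum hms hs.2.1 (exists_isRegular_of_mem_sources hs) (H i)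
      Finset.univ).resolve_left fun h => ?_
    -- A zero row of `H` would contradict `H H⁻¹ = 1`.
    have := congrFun (congrFun (Matrix.mul_nonsing_inv H hu) i) i
    simp [Matrix.mul_apply, fun j => h j (Finset.mem_univ j)] at this
  set c : Fin n → ℝ := fun i => (Real.sqrt (variance (fun ω => act H s ω i) P))⁻¹ with hc
  have hc0 : ∀ i, c i ≠ 0 := fun i => by
    obtain ⟨g, hg, hgr⟩ := hlin i
    have h1 := variance_ne_zero_of_isPDF (hyi i) hg hgr.2.1
    exact inv_ne_zero (Real.sqrt_ne_zero'.2 (lt_of_le_of_ne (variance_nonneg _ _) h1.symm))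
  set m : Fin n → ℝ := fun i => ∫ ω, act H s ω i ∂P with hm
  have hz : ∀ ω i, normalize P (act H s) ω i = c i * act H s ω i + -(c i * m i) := fun ω i => by
    simp only [normalize, hc, hm]
    ring
  set M : Matrix (Fin n) (Fin n) ℝ := Matrix.diagonal c * H with hM
  set b : Fin n → ℝ := fun i => -(c i * m i) with hb
  have hMG : M * (H⁻¹ * Matrix.diagonal c⁻¹) = 1 := by
    rw [hM, Matrix.mul_assoc, ← Matrix.mul_assoc H, Matrix.mul_nonsing_inv H hu, Matrix.one_mul,
      Matrix.diagonal_mul_diagonal, ← Matrix.diagonal_one]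
    congr 1
    ext i
    simp [hc0 i]
  have hGM : (H⁻¹ * Matrix.diagonal c⁻¹) * M = 1 := mul_eq_one_comm.1 hMG
  have hzM : normalize P (act H s) = (fun x => mulVecEquiv hMG hGM x + b) ∘ s := by
    ext ω i
    rw [hz]
    simp only [Function.comp_apply, Pi.add_apply, mulVecEquiv_apply, hM, ← Matrix.mulVec_mulVec,
      Matrix.mulVec_diagonal, hb, act]
  have hmarg : ∀ i, ∃ g, IsPDF ((P.map (normalize P (act H s))).map fun z : Fin n → ℝ => z i) g ∧
      IsRegular p g := fun i => by
    have h1 := exists_isRegular_map_mul_add (hlin i) (hc0 i) (-(c i * m i))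
    rw [Measure.map_map (by fun_prop) (hyi i)] at h1
    rw [Measure.map_map (by fun_prop) (measurable_normalize _ hy)]
    have h2 : (fun z : Fin n → ℝ => z i) ∘ normalize P (act H s)
        = (fun t => c i * t + -(c i * m i)) ∘ fun ω => act H s ω i := by
      ext ω; exact hz ω i
    rwa [h2]
  choose g hg hgr using hmarg
  have hprob : ∀ i, IsProbabilityMeasure (P.map fun ω => s ω i) := fun i =>
    Measure.isProbabilityMeasure_map (hmsi i).aemeasurable
  refine ⟨M, _, b, f, g, ⟨hMG, hGM, hfr, fun i => ?_, hgr, ?_, hg⟩, fun k j hkj => ?_⟩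
  · by_contra h0
    rw [not_nonempty_iff_eq_empty, support_eq_empty_iff] at h0
    have h1 := (hprob i).measure_univ
    rw [(hf i).2.2, h0] at h1
    simp at h1
  · have h1 := isPDF_prodFun hf
    rw [← (iIndepFun_iff_map_fun_eq_pi_map fun i => (hmsi i).aemeasurable).1 hs.2.1] at h1
    have h2 := h1.map_affine (mulVecEquiv hMG hGM) b
    rw [Measure.map_map (by fun_prop) (by exact hms)] at h2
    simp only [det_mulVecEquiv, mulVecEquiv_symm_apply] at h2
    rw [hzM]
    exact h2
  · rw [hM, Matrix.diagonal_mul]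
    exact mul_ne_zero (hc0 k) hkj

/-- Normalization acts on each component separately, hence preserves independence. -/
theorem hfdMeasure_of_mem_sources [IsProbabilityMeasure P] (hp : 1 ≤ p) {s : Ω → Fin n → ℝ} (hs : s ∈ sources P n p) :
    hfdMeasure P p (act 1 s) = 0 := by
  obtain ⟨M, G, b, f, g, h, -⟩ := exists_isMixtureLaw hs (one_mem_linearFilters (n := n))
  have hm := measurable_normalize P (measurable_act 1 hs.1)
  have : IsProbabilityMeasure (P.map (normalize P (act 1 s))) :=
    Measure.isProbabilityMeasure_map hm.aemeasurable
  refine hfdNorm_eq_zero_of_pi h hp ?_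
  rw [act_one] at *
  have hind : iIndepFun (fun i ω => normalize P s ω i) P :=
    hs.2.1.comp (fun i t => (t - ∫ ω', s ω' i ∂P) / Real.sqrt (variance (fun ω' => s ω' i) P))
      fun i => by fun_prop
  have h1 := (iIndepFun_iff_map_fun_eq_pi_map fun i =>
    ((measurable_pi_apply i).comp hm).aemeasurable).1 hind
  refine h1.trans ?_
  congr 1
  ext1 i
  rw [Measure.map_map (by fun_prop) hm]

theorem hfdCriterion_trivial [IsProbabilityMeasure P] (hp : 1 ≤ p) {x : Ω → Fin n → ℝ}
    (hx : x ∈ mixtures (linearFilters n) (sources P n p)) {T : Matrix (Fin n) (Fin n) ℝ}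
    (hT : T ∈ trivialFilters n) : hfdCriterion P p T x = hfdCriterion P p 1 x := by
  obtain ⟨σ, d, hd, rfl⟩ := hT
  have hxm := measurable_of_mem_mixtures hx
  obtain ⟨H, hH, s, hs, hxs⟩ := hx
  obtain ⟨M, G, b, f, g, h, -⟩ := exists_isMixtureLaw hs hH
  rw [← hxs] at h
  have hT : ∀ ω i, act (σ.permMatrix ℝ * Matrix.diagonal d) x ω i = d (σ i) * x ω (σ i) :=
    fun ω i => by
      rw [act, ← Matrix.mulVec_mulVec, Matrix.permMatrix_mulVec]
      exact Matrix.mulVec_diagonal _ _ _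
  -- Scaling by `d` multiplies the standard deviation by `|d|`, so only the sign `d / |d|` survives.
  have hn : normalize P (act (σ.permMatrix ℝ * Matrix.diagonal d) x)
      = (fun (z : Fin n → ℝ) i => d (σ i) / |d (σ i)| * z (σ i)) ∘ normalize P x := by
    ext ω i
    simp only [normalize, hT, Function.comp_apply, integral_const_mul, variance_const_mul]
    rw [Real.sqrt_mul (sq_nonneg _), Real.sqrt_sq_eq_abs]
    ring
  rw [hfdCriterion, hfdCriterion, act_one, hfdMeasure, hfdMeasure, hn,
    ← Measure.map_map (by fun_prop) (measurable_normalize P hxm),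
    h.hfdNorm_map_signedPerm hp σ (ε := fun i => d (σ i) / |d (σ i)|)]
  intro i
  rw [abs_div, abs_abs, div_self (abs_ne_zero.2 (hd _))]

theorem mem_trivialFilters_of_hfdCriterion_eq [IsProbabilityMeasure P] (hp : 1 ≤ p) {s : Ω → Fin n → ℝ}
    (hs : s ∈ sources P n p) {H : Matrix (Fin n) (Fin n) ℝ} (hH : H ∈ linearFilters n)
    (h : hfdCriterion P p H s = hfdCriterion P p 1 s) : H ∈ trivialFilters n := by
  obtain ⟨M, G, b, f, g, hl, hM⟩ := exists_isMixtureLaw hs hH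
  have h0 : hfdNorm p (P.map (normalize P (act H s))) = 0 := by
    rw [hfdCriterion, hfdCriterion, hfdMeasure_of_mem_sources hp hs, neg_inj] at h
    exact h
  exact mem_trivialFilters_of_row hH fun k j j' hj hj' =>
    hl.row_of_hfdNorm_eq_zero hp h0 (hM k j hj) (hM k j' hj')

end Mixtures

end HFDContrast

/-! ### The contrast theorem -/

theorem mainTheorem11 {Ω : Type*} [MeasurableSpace Ω] (P : Measure Ω) [IsProbabilityMeasure P]
    (n : ℕ) (p : ℝ) (hp : 1 ≤ p) :
    -- the criterion is well defined and finite on all mixtures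
    (∀ y ∈ HFDContrast.mixtures (HFDContrast.linearFilters n) (HFDContrast.sources P n p),
      HFDContrast.HasRegularPDF (P.map (HFDContrast.normalize P y)) ∧
      (∀ i, HFDContrast.HasRegularPDF
        ((P.map (HFDContrast.normalize P y)).map (fun z : Fin n → ℝ => z i))) ∧
      ∀ i j, MemLp (fun z => HFDContrast.HFD (P.map (HFDContrast.normalize P y)) z i j)
        (ENNReal.ofReal p) volume) ∧
    -- it is a contrast
    HFDContrast.IsContrast P (HFDContrast.linearFilters n) (HFDContrast.trivialFilters n)
      (HFDContrast.sources P n p) (HFDContrast.hfdCriterion P p) ∧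
    -- the trivial filters are exactly the filters that leave the criterion unchanged
    ((HFDContrast.sources P n p).Nonempty →
      HFDContrast.trivialFilters n =
        {T | T ∈ HFDContrast.linearFilters n ∧
          ∀ x ∈ HFDContrast.mixtures (HFDContrast.linearFilters n) (HFDContrast.sources P n p),
            HFDContrast.hfdCriterion P p T x = HFDContrast.hfdCriterion P p 1 x}) := by
  have hcontrast : HFDContrast.IsContrast P (HFDContrast.linearFilters n)
      (HFDContrast.trivialFilters n) (HFDContrast.sources P n p)
      (HFDContrast.hfdCriterion P p) :=
    { one_mem := HFDContrast.one_mem_linearFilters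
      trivial_subset := HFDContrast.trivialFilters_subset_linearFilters
      depends_on_law := fun H _ x hx x' hx' h => HFDContrast.hfdCriterion_eq_of_map_eq H
        (HFDContrast.measurable_of_mem_mixtures hx) (HFDContrast.measurable_of_mem_mixtures hx') h
      invariance := fun x hx T hT => HFDContrast.hfdCriterion_trivial hp hx hT
      dominance := fun s hs H _ => by
        rw [HFDContrast.hfdCriterion, HFDContrast.hfdCriterion,
          HFDContrast.hfdMeasure_of_mem_sources hp hs, neg_zero, neg_nonpos]
        exact HFDContrast.hfdNorm_nonneg _ _
      discrimination := fun s hs H hH h =>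
        HFDContrast.mem_trivialFilters_of_hfdCriterion_eq hp hs hH h }
  refine ⟨?_, hcontrast, ?_⟩
  · rintro y ⟨H, hH, s, hs, rfl⟩
    obtain ⟨M, G, b, f, g, h, -⟩ := HFDContrast.exists_isMixtureLaw hs hH
    exact ⟨h.hasRegularPDF hp, h.hasRegularPDF_marginal, h.memLp_hfd hp⟩
  -- A single source vector, itself a mixture, already detects every nontrivial filter by
  -- discrimination.
  · rintro ⟨s, hs⟩
    ext T
    refine ⟨fun hT => ⟨hcontrast.trivial_subset hT, fun x hx => hcontrast.invariance x hx T hT⟩,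
      fun hT => hcontrast.discrimination s hs T hT.1
        (hT.2 s (HFDContrast.mem_mixtures_of_mem_sources hs))⟩
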